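/- **Machines.** A probabilistic finite state transducer (pfst) consists of a finite state set $Q$, finite input and output alphabets $\Sigma_1,\Sigma_2$, an initial state $q_0\in Q$, disjoint sets $Q_{\rm acc},Q_{\rm rej}\subseteq Q$ of accepting and rejecting states (the others are non-halting), and, for each symbol $a\in\Sigma_1\cup\{\ddag,\$\}$ ($\ddag,\$$ being the initial and end markers), a row-stochastic real matrix $V_a=((V_a)_{qp})_{q,p\in Q}$ and an output function $f_a:Q\to\Sigma_2^*$; it is required that $(V_\$)_{qp}=0$ for $p\notin Q_{\rm acc}\cup Q_{\rm rej}$. A quantum finite state transducer (qfst) is defined in the same way with unitary complex matrices $V_a$, where $(V_\$)_{qp}=0$ is required for $q,p\notin Q_{\rm acc}\cup Q_{\rm rej}$. On input $v\in\Sigma_1^*$ the machine starts in $q_0$ with an empty output tape and reads $\ddag v\$$ from left to right. Reading $a$ in state $q$, it appends $f_a(q)$ to the output and moves to state $p$ with probability $(V_a)_{qp}$ (pfst), respectively applies $|q\rangle\otimes|w\rangle\mapsto\sum_p (V_a)_{qp}|p\rangle\otimes|wf_a(q)\rangle$, extended linearly (qfst). After each step a pfst that is in a halting state stops, accepting (with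 the word on the output tape) or rejecting; for a qfst it is measured whether the state is non-halting, accepting (in which case the output tape is observed too) or rejecting, and in the last two cases the computation stops. Let $T(w|v)$ be the total probability that $v$ is accepted with output $w$. For $\alpha>1/2$, $T$ *computes the relation* $\mathcal R\subseteq\Sigma_1^*\times\Sigma_2^*$ *with probability* $\alpha$ if for all $v,w$: $(v,w)\in\mathcal R$ implies $T(w|v)\ge\alpha$, and $(v,w)\notin\mathcal R$ implies $T(w|v)\le 1-\alpha$. **Descriptions.** Fix a partial map $\nu$ from $\mathbb N$ to $\mathbb R$ (for pfst) or to $\mathbb C$ (for qfst), the naming of numbers, such that every rational number has at least one name. A machine whose states and letters are numbered is described by the finite list of its data, each matrix entry being given by a name. **Theorem.** For every such $\nu$, the emptiness problem for pfst computing a relation with probability $2/3$ is undecidable: there is no algorithm (partial recursive function) which, given any description of a pfst that computes some relation $\mathcal R$ with probability $2/3$, halts and correctly tells whether $\mathcal R=\emptyset$ (its behaviour on all other inputs being arbitrary). Likewise, for every such $\nu$, the emptiness problem for qfst computing a relation with probability $2/3$ is undecidable in the same sense. -/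

import Mathlib

/-! Probabilistic and quantum finite state transducers, the relations they compute, and
finite descriptions of such machines. -/

/-- A symbol on the input tape: the initial marker, a letter of the input alphabet, or the
end marker. -/
inductive TapeSymbol (A : Type*) where
  | initMark : TapeSymbol A
  | letter (a : A) : TapeSymbol A
  | endMark : TapeSymbol A

/-- The content of the input tape for the input word `v`: `v` between the two markers. -/
def tape {A : Type*} (v : List A) : List (TapeSymbol A) :=
  TapeSymbol.initMark :: (v.map TapeSymbol.letter ++ [TapeSymbol.endMark])

/-- The data `(Q, A, B, V, f, q₀, Q_acc, Q_rej)` shared by probabilistic (`K = ℝ`) and quantum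
(`K = ℂ`) finite state transducers: `V s q p` is the weight of the transition from `q` to `p`
when the symbol `s` is read, and `f s q` is the word printed when `s` is read in state `q`. -/
structure Transducer (K Q A B : Type*) where
  V : TapeSymbol A → Matrix Q Q K
  f : TapeSymbol A → Q → List B
  q₀ : Q
  acc : Finset Q
  rej : Finset Q
  disjoint_acc_rej : Disjoint acc rej

namespace Transducer

variable {K Q A B : Type*}

/-- The linear map `|q⟩ ⊗ |w⟩ ↦ ∑ p, V s q p |p⟩ ⊗ |w f_s(q)⟩` on finitely supported
combinations of configurations (state, content of the output tape). -/
noncomputable def move [Semiring K] [Fintype Q] (T : Transducer K Q A B) (s : TapeSymbol A)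
    (ψ : (Q × List B) →₀ K) : (Q × List B) →₀ K :=
  ψ.sum fun x c => ∑ p : Q, Finsupp.single (p, x.2 ++ T.f s x.1) (c * T.V s x.1 p)

end Transducer

/-- A total state: the part that has not halted, the probability of having accepted with each
output word, and the probability of having rejected. -/
structure TotalState (K Q B : Type*) [Zero K] where
  non : (Q × List B) →₀ K
  acc : List B → ℝ
  rej : ℝ

/-- The total state `((q₀, ε), 0, 0)` before the first step. -/
noncomputable def Transducer.init {K Q A B : Type*} [Semiring K] (T : Transducer K Q A B) :
    TotalState K Q B where
  non := Finsupp.single (T.q₀, []) 1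
  acc := fun _ => 0
  rej := 0

/-- `P w v` stands for the probability that the input `v` is accepted with output `w`. The
relation `R` is computed with probability `α` (used for `α > 1/2`). -/
def ComputesWithProb {A B : Type*} (P : List B → List A → ℝ) (R : Set (List A × List B))
    (α : ℝ) : Prop :=
  ∀ (v : List A) (w : List B),
    ((v, w) ∈ R → α ≤ P w v) ∧ ((v, w) ∉ R → P w v ≤ 1 - α)

/-- A probabilistic finite state transducer: all transition matrices are (row) stochastic, and
the end marker leads to halting states only. -/
structure PFST (Q A B : Type*) [Fintype Q] [DecidableEq Q] extends Transducer ℝ Q A B where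
  stochastic : ∀ s : TapeSymbol A, V s ∈ Matrix.rowStochastic ℝ Q
  endMark_halts : ∀ q p : Q, p ∉ acc → p ∉ rej → V TapeSymbol.endMark q p = 0

namespace PFST

variable {Q A B : Type*} [Fintype Q] [DecidableEq Q]

/-- The transformation of the total state when the symbol `s` is read. -/
noncomputable def step (T : PFST Q A B) (S : TotalState ℝ Q B) (s : TapeSymbol A) :
    TotalState ℝ Q B where
  non := (T.move s S.non).filter fun x => x.1 ∉ T.acc ∧ x.1 ∉ T.rej
  acc := fun w => S.acc w + ∑ p ∈ T.acc, T.move s S.non (p, w)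
  rej := S.rej + (T.move s S.non).sum fun x c => if x.1 ∈ T.rej then c else 0

/-- The total state after the computation on the input `v`. -/
noncomputable def final (T : PFST Q A B) (v : List A) : TotalState ℝ Q B :=
  (tape v).foldl T.step T.init

/-- `T(w | v)`: the probability to accept the input `v` after having produced the output `w`. -/
noncomputable def prob (T : PFST Q A B) (w : List B) (v : List A) : ℝ :=
  (T.final v).acc w

/-- `T` computes the relation `R` with probability `α`. -/
def Computes (T : PFST Q A B) (R : Set (List A × List B)) (α : ℝ) : Prop :=
  ComputesWithProb T.prob R α

end PFST

/-- A quantum finite state transducer: all transition matrices are unitary, and the end marker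
carries no amplitude from a non-halting state to a non-halting state. -/
structure QFST (Q A B : Type*) [Fintype Q] [DecidableEq Q] extends Transducer ℂ Q A B where
  unitary : ∀ s : TapeSymbol A, V s ∈ Matrix.unitaryGroup Q ℂ
  endMark_halts : ∀ q p : Q, q ∉ acc → q ∉ rej → p ∉ acc → p ∉ rej → V TapeSymbol.endMark q p = 0

namespace QFST

variable {Q A B : Type*} [Fintype Q] [DecidableEq Q]

/-- The transformation of the total state when the symbol `s` is read: a unitary move, followed
by the measurement of "non-halting / accepting (with the output) / rejecting". -/
noncomputable def step (T : QFST Q A B) (S : TotalState ℂ Q B) (s : TapeSymbol A) :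
    TotalState ℂ Q B where
  non := (T.move s S.non).filter fun x => x.1 ∉ T.acc ∧ x.1 ∉ T.rej
  acc := fun w => S.acc w + ∑ p ∈ T.acc, ‖T.move s S.non (p, w)‖ ^ 2
  rej := S.rej + (T.move s S.non).sum fun x c => if x.1 ∈ T.rej then ‖c‖ ^ 2 else 0

/-- The total state after the computation on the input `v`. -/
noncomputable def final (T : QFST Q A B) (v : List A) : TotalState ℂ Q B :=
  (tape v).foldl T.step T.init

/-- `T(w | v)`: the probability to accept the input `v` after having produced the output `w`. -/
noncomputable def prob (T : QFST Q A B) (w : List B) (v : List A) : ℝ :=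
  (T.final v).acc w

/-- `T` computes the relation `R` with probability `α`. -/
def Computes (T : QFST Q A B) (R : Set (List A × List B)) (α : ℝ) : Prop :=
  ComputesWithProb T.prob R α

end QFST

/-- Raw finite descriptions of transducers. The states are `0, …, states - 1`, and likewise for
the two alphabets. The lists `matrix` and `output` are indexed by tape symbols, then by
states; `matrix` holds names of numbers, `output` holds output words. -/
structure TransducerCode where
  states : ℕ
  inputs : ℕ
  outputs : ℕ
  initial : ℕ
  acc : List ℕ
  rej : List ℕ
  matrix : List (List (List ℕ))
  output : List (List (List ℕ))

namespace TransducerCode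

/-- A description as a tuple. -/
def equivTuple : TransducerCode ≃
    ℕ × ℕ × ℕ × ℕ × List ℕ × List ℕ × List (List (List ℕ)) × List (List (List ℕ)) where
  toFun c := (c.states, c.inputs, c.outputs, c.initial, c.acc, c.rej, c.matrix, c.output)
  invFun t := ⟨t.1, t.2.1, t.2.2.1, t.2.2.2.1, t.2.2.2.2.1, t.2.2.2.2.2.1, t.2.2.2.2.2.2.1,
    t.2.2.2.2.2.2.2⟩
  left_inv _ := rfl
  right_inv _ := rfl

instance : Primcodable TransducerCode := Primcodable.ofEquiv _ equivTuple

/-- Position of a tape symbol in the lists `matrix` and `output`. -/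
def symbolIndex {k : ℕ} : TapeSymbol (Fin k) → ℕ
  | TapeSymbol.initMark => 0
  | TapeSymbol.endMark => 1
  | TapeSymbol.letter a => a + 2

/-- The name stored for the transition from `q` to `p` at the tape symbol number `s`, if any. -/
def entry (c : TransducerCode) (s q p : ℕ) : Option ℕ :=
  ((c.matrix[s]?).bind fun M => M[q]?).bind fun row => row[p]?

/-- The output word stored for the state `q` and the tape symbol number `s`, if any. -/
def word (c : TransducerCode) (s q : ℕ) : Option (List ℕ) :=
  (c.output[s]?).bind fun F => F[q]?

/-- With numbers named by `ν` (where `ν n = none` if `n` is not a name), `c` is a description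
of the transducer `T`. -/
def Describes {K : Type*} (ν : ℕ → Option K) (c : TransducerCode)
    (T : Transducer K (Fin c.states) (Fin c.inputs) (Fin c.outputs)) : Prop :=
  (T.q₀ : ℕ) = c.initial ∧
  (∀ q : Fin c.states, q ∈ T.acc ↔ (q : ℕ) ∈ c.acc) ∧
  (∀ q : Fin c.states, q ∈ T.rej ↔ (q : ℕ) ∈ c.rej) ∧
  (∀ (s : TapeSymbol (Fin c.inputs)) (q p : Fin c.states),
    (c.entry (symbolIndex s) q p).bind ν = some (T.V s q p)) ∧
  (∀ (s : TapeSymbol (Fin c.inputs)) (q : Fin c.states),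
    c.word (symbolIndex s) q = some ((T.f s q).map fun b => (b : ℕ)))

end TransducerCode

/-- The emptiness problem for probabilistic finite state transducers computing a relation with
probability `α` is decidable, where transition probabilities are named by `ν`: some algorithm,
given any description of a transducer that computes some relation `R` with probability `α`,
halts and tells whether `R` is empty. (Nothing is required of it on other inputs.) -/
def PFST.EmptinessDecidable (ν : ℕ → Option ℝ) (α : ℝ) : Prop :=
  ∃ d : TransducerCode →. Bool, Partrec d ∧
    ∀ (c : TransducerCode) (T : PFST (Fin c.states) (Fin c.inputs) (Fin c.outputs))
      (R : Set (List (Fin c.inputs) × List (Fin c.outputs))),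
      c.Describes ν T.toTransducer → T.Computes R α →
        ∃ b ∈ d c, (b = true ↔ R = ∅)

/-- The emptiness problem for quantum finite state transducers computing a relation with
probability `α` is decidable, where transition amplitudes are named by `ν`. -/
def QFST.EmptinessDecidable (ν : ℕ → Option ℂ) (α : ℝ) : Prop :=
  ∃ d : TransducerCode →. Bool, Partrec d ∧
    ∀ (c : TransducerCode) (T : QFST (Fin c.states) (Fin c.inputs) (Fin c.outputs))
      (R : Set (List (Fin c.inputs) × List (Fin c.outputs))),
      c.Describes ν T.toTransducer → T.Computes R α →
        ∃ b ∈ d c, (b = true ↔ R = ∅)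

/-! The proof reduces the halting problem to Post's correspondence problem with a fixed list of
dominoes and a varying suffix, and then builds a transducer that computes the set of solutions.

Given words `u a`, `v a` and a suffix `s`, a machine splits into nine branches of probability 1/9
each: three print the image of the input under `u` followed by `s` and accept, three print the image
under `v` and accept, three reject. An output `w` thus has probability 2/3 if both images equal `w`,
and at most 1/3 otherwise. So the machine computes with probability 2/3 a relation that is nonempty
exactly when the correspondence problem is solvable. Nine branches rather than three make the
quantum amplitude the rational number 1/3, and a Householder reflection completes the row of these
amplitudes to a rational unitary matrix (`pfst_computes`, `qfst_computes`). Since every rational has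
a name and the finitely many entries do not depend on `s`, the names are constants of the reduction,
so nothing effective is needed of `ν`.

Undecidability comes from one Turing machine whose halting on the tapes `x y z z ... z` is
undecidable (`exists_TM0_not_computablePred_halts`). Its runs are derivations of a semi-Thue system,
and these are solutions of a correspondence problem with a prefix encoding the tape
(`eval_dom_iff_exists_isPrefixedSolution`). Reversing all words turns the prefix into a suffix. This
matters because at the initial marker the machine has not yet split, while at the end marker only
the `u`-branches can be made to print. -/

open Turing

/-! ### A fixed finite Turing machine with undecidable halting. -/

/-- A machine all of whose reachable states lie in a finite set can be replaced by one with a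
finite type of states. -/
theorem Turing.TM0.exists_fintype_of_supports {Γ Λ : Type} [Inhabited Γ] [Inhabited Λ]
    (M : TM0.Machine Γ Λ) (S : Finset Λ) (hS : TM0.Supports M (S : Set Λ)) :
    ∃ (Λ' : Type) (_ : Inhabited Λ') (_ : Fintype Λ') (M' : TM0.Machine Γ Λ'),
      ∀ l, (TM0.eval M' l).Dom ↔ (TM0.eval M l).Dom := by
  classical
  let _ : Inhabited S := ⟨⟨default, hS.1⟩⟩
  -- The inner `none` is never used: `S` is closed under the transitions of `M`.
  let M' : TM0.Machine Γ S := fun q a =>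
    (M q a).bind fun p => if h : p.1 ∈ S then some (⟨p.1, h⟩, p.2) else none
  refine ⟨S, inferInstance, inferInstance, M', fun l => ?_⟩
  refine StateTransition.tr_eval_dom (f₁ := TM0.step M) (f₂ := TM0.step M')
    (tr := fun c d => c.q = d.q.1 ∧ c.Tape = d.Tape) ?_ ⟨rfl, rfl⟩
  rintro ⟨q, T⟩ ⟨⟨q', hq⟩, T'⟩ ⟨h₁, h₂⟩
  dsimp only at h₁ h₂
  subst h₁ h₂
  cases h : M q T.1 with
  | none => simp [TM0.step, M', h]
  | some p =>
    have hp : p.1 ∈ S := hS.2 (q' := p.1) (s := p.2) h hq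
    simp only [TM0.step, h, Option.map_some]
    refine ⟨⟨⟨p.1, hp⟩, _⟩, ⟨rfl, rfl⟩, Relation.TransGen.single ?_⟩
    simp [TM0.step, M', h, hp]

/-- Digits are stored with the least significant one first. Powers of two serve as inputs because
`m` then enters the tape only as the length of a constant run. -/
theorem Turing.PartrecToTM2.trNat_two_pow (m : ℕ) :
    PartrecToTM2.trNat (2 ^ m) =
      List.replicate m PartrecToTM2.Γ'.bit0 ++ [PartrecToTM2.Γ'.bit1] := by
  have key : ((2 ^ m : ℕ) : Num) = Num.pos (Nat.rec PosNum.one (fun _ => PosNum.bit0) m) := by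
    induction m with
    | zero => rfl
    | succ m ih =>
      rw [pow_succ, mul_two, Nat.cast_add, ih, Num.bit0_of_bit0]
      rfl
  rw [PartrecToTM2.trNat, key]
  clear key
  induction m with
  | zero => rfl
  | succ m ih => exact congrArg (List.cons PartrecToTM2.Γ'.bit0) ih

instance Turing.PartrecToTM2.K'.instFintype : Fintype PartrecToTM2.K' where
  elems := {.main, .rev, .aux, .stack}
  complete x := by cases x <;> simp

theorem Turing.TM2to1.trInit_main_two_pow (m : ℕ) :
    TM2to1.trInit (Γ := fun _ : PartrecToTM2.K' => PartrecToTM2.Γ') PartrecToTM2.K'.main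
        (PartrecToTM2.trList [2 ^ m]) =
      (true, Function.update (fun _ => none) PartrecToTM2.K'.main (some .cons)) ::
      (false, Function.update (fun _ => none) PartrecToTM2.K'.main (some .bit1)) ::
      List.replicate m
        (false, Function.update (fun _ => none) PartrecToTM2.K'.main (some .bit0)) := by
  simp only [TM2to1.trInit, PartrecToTM2.trList, PartrecToTM2.trNat_two_pow, List.reverse_append,
    List.reverse_cons, List.reverse_nil, List.nil_append, List.cons_append, List.append_assoc,
    List.reverse_replicate]
  refine congrArg (List.cons _) (congrArg (List.cons _) ?_)
  exact List.map_replicate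

theorem exists_code_dom_iff_halts :
    ∃ c : ToPartrec.Code, ∀ m : ℕ, (c.eval [2 ^ m]).Dom ↔
      ((Denumerable.ofNat Nat.Partrec.Code m).eval 0).Dom := by
  -- This function decodes the input by searching for its binary logarithm, so one program simulates
  -- all codes.
  let f : ℕ →. ℕ := fun x => (Nat.rfind fun k => (2 ^ k == x : Bool)).bind fun m =>
    (Denumerable.ofNat Nat.Partrec.Code m).eval 0
  have hpow : Primrec₂ fun k x : ℕ => (2 ^ k == x : Bool) := by
    have : Primrec fun k : ℕ => 2 ^ k := by
      refine (Primrec.nat_rec₁ 1 (Primrec.nat_mul.comp (Primrec.const 2) Primrec.snd).to₂).of_eq ?_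
      intro k
      induction k with
      | zero => rfl
      | succ k ih => simp only [ih]; rw [pow_succ, mul_comm]
    exact Primrec.beq.comp (this.comp Primrec.fst) Primrec.snd
  have hf : Partrec f := by
    refine Partrec.bind (Partrec.rfind (p := fun x k => ((2 ^ k == x : Bool) : Part Bool)) ?_) ?_
    · exact (hpow.comp Primrec.snd Primrec.fst).to_comp.partrec
    · exact Nat.Partrec.Code.eval_part.comp ((Computable.ofNat _).comp Computable.snd)
        (Computable.const 0)
  have hf' : Nat.Partrec' fun v : List.Vector ℕ 1 => f v.head :=
    Nat.Partrec'.part_iff₁.2 hf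
  obtain ⟨c, hc⟩ := ToPartrec.Code.exists_code hf'
  refine ⟨c, fun m => ?_⟩
  have h1 : c.eval [2 ^ m] = pure <$> f (2 ^ m) := hc ⟨[2 ^ m], rfl⟩
  have h2 : (Nat.rfind fun k => ((2 ^ k == 2 ^ m : Bool) : Part Bool)) = Part.some m := by
    refine Part.eq_some_iff.2 (Nat.mem_rfind.2 ⟨?_, ?_⟩)
    · simp
    · intro k hk
      simp [hk.ne]
  have h3 : f (2 ^ m) = (Denumerable.ofNat Nat.Partrec.Code m).eval 0 := by
    simp only [f]
    erw [h2]
    simp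
  rw [h1, h3]
  rfl

theorem exists_TM0_not_computablePred_halts :
    ∃ (Γ Λ : Type) (_ : Inhabited Γ) (_ : Inhabited Λ) (_ : Fintype Γ) (_ : Fintype Λ)
      (M : TM0.Machine Γ Λ) (x y z : Γ),
      ¬ ComputablePred fun m : ℕ => (TM0.eval M (x :: y :: List.replicate m z)).Dom := by
  obtain ⟨c, hc⟩ := exists_code_dom_iff_halts
  -- A `TM0` run starts in the default state, so the program `c` is loaded by choosing the default.
  let _ : Inhabited PartrecToTM2.Λ' := ⟨PartrecToTM2.trNormal c .halt⟩
  have hS := TM1to0.tr_supports _ (TM2to1.tr_supports _ (PartrecToTM2.tr_supports c .halt))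
  obtain ⟨Λ, iΛ, fΛ, M, hM⟩ := TM0.exists_fintype_of_supports _ _ hS
  have key : ∀ m, (TM0.eval M (TM2to1.trInit
      (Γ := fun _ : PartrecToTM2.K' => PartrecToTM2.Γ') PartrecToTM2.K'.main
        (PartrecToTM2.trList [2 ^ m]))).Dom ↔
      ((Denumerable.ofNat Nat.Partrec.Code m).eval 0).Dom := by
    intro m
    rw [hM, TM1to0.tr_eval, ← hc]
    refine (TM2to1.tr_eval_dom (Γ := fun _ : PartrecToTM2.K' => PartrecToTM2.Γ')
      PartrecToTM2.tr _ _).trans ?_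
    have h1 := PartrecToTM2.tr_eval c [2 ^ m]
    have h2 : (TM2.init PartrecToTM2.K'.main (PartrecToTM2.trList [2 ^ m]) :
        PartrecToTM2.Cfg') = PartrecToTM2.init c [2 ^ m] := by
      simp only [TM2.init, PartrecToTM2.init]
      congr 1
      funext k
      cases k <;> rfl
    change (StateTransition.eval (TM2.step PartrecToTM2.tr)
      (TM2.init PartrecToTM2.K'.main (PartrecToTM2.trList [2 ^ m]) :
        PartrecToTM2.Cfg')).Dom ↔ _
    rw [h2, h1]
    rfl
  simp only [TM2to1.trInit_main_two_pow] at key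
  refine ⟨TM2to1.Γ' PartrecToTM2.K' fun _ => PartrecToTM2.Γ', Λ, inferInstance, iΛ,
    inferInstance, fΛ, M,
    (true, Function.update (fun _ => none) PartrecToTM2.K'.main (some .cons)),
    (false, Function.update (fun _ => none) PartrecToTM2.K'.main (some .bit1)),
    (false, Function.update (fun _ => none) PartrecToTM2.K'.main (some .bit0)), fun h =>
      ComputablePred.halting_problem 0 ?_⟩
  obtain ⟨g, hg, hg'⟩ := ComputablePred.computable_iff.1 (h.of_eq key)
  refine ComputablePred.computable_iff.2 ⟨fun c => g (Encodable.encode c),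
    hg.comp Computable.encode, ?_⟩
  funext c
  simpa using congrFun hg' (Encodable.encode c)

/-! ### Simulation of Turing machines by semi-Thue systems. -/

/-- One step of the semi-Thue system with the rules `l i → r i`. -/
def SemiThue {ι α : Type*} (l r : ι → List α) (x y : List α) : Prop :=
  ∃ i A B, x = A ++ l i ++ B ∧ y = A ++ r i ++ B

/-- Symbols of the words that describe configurations of a Turing machine: letters on the tape,
states, the two ends of the tape, a symbol for a machine that has halted, and a symbol for the
end of the derivation. -/
inductive ConfigSymbol (Γ Λ : Type*)
  | cell (a : Γ)
  | state (q : Λ)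
  | left
  | right
  | halted
  | done

/-- The rules of the semi-Thue system that simulates a Turing machine. -/
inductive ConfigRule (Γ Λ : Type*)
  | padLeft
  | padRight
  | move (b : Γ) (q : Λ) (a : Γ)
  | eatLeft (b : Γ)
  | eatRight (b : Γ)
  | finish

namespace ConfigSymbol

instance {Γ Λ : Type*} [Finite Γ] [Finite Λ] : Finite (ConfigSymbol Γ Λ) := by
  let f : ConfigSymbol Γ Λ → Γ ⊕ Λ ⊕ Fin 4 := fun x => match x with
    | cell a => .inl a
    | state q => .inr (.inl q)
    | left => .inr (.inr 0)
    | right => .inr (.inr 1)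
    | halted => .inr (.inr 2)
    | done => .inr (.inr 3)
  refine Finite.of_injective f ?_
  intro x y h
  cases x <;> cases y <;> simp_all [f]

end ConfigSymbol

namespace ConfigRule

open ConfigSymbol

instance {Γ Λ : Type*} [Finite Γ] [Finite Λ] : Finite (ConfigRule Γ Λ) := by
  let f : ConfigRule Γ Λ → (Γ × Λ × Γ) ⊕ Γ ⊕ Γ ⊕ Fin 3 := fun x => match x with
    | move b q a => .inl (b, q, a)
    | eatLeft b => .inr (.inl b)
    | eatRight b => .inr (.inr (.inl b))
    | padLeft => .inr (.inr (.inr 0))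
    | padRight => .inr (.inr (.inr 1))
    | finish => .inr (.inr (.inr 2))
  refine Finite.of_injective f ?_
  intro x y h
  cases x <;> cases y <;> simp_all [f]

variable {Γ Λ : Type*}

/-- The left-hand side of a rule. -/
def lhs : ConfigRule Γ Λ → List (ConfigSymbol Γ Λ)
  | padLeft => [left]
  | padRight => [right]
  | move b q a => [cell b, state q, cell a]
  | eatLeft b => [cell b, halted]
  | eatRight b => [halted, cell b]
  | finish => [left, halted, right]

/-- The right-hand side of a rule. -/
def rhs [Inhabited Γ] [Inhabited Λ] (M : TM0.Machine Γ Λ) : ConfigRule Γ Λ → List (ConfigSymbol Γ Λ)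
  | padLeft => [left, cell default]
  | padRight => [cell default, right]
  | move b q a => match M q a with
    | none => [halted]
    | some (q', .move .left) => [state q', cell b, cell a]
    | some (q', .move .right) => [cell b, cell a, state q']
    | some (q', .write a') => [cell b, state q', cell a']
  | eatLeft _ => [halted]
  | eatRight _ => [halted]
  | finish => [done]

end ConfigRule

namespace Turing.TM0

open ConfigSymbol ConfigRule

variable {Γ Λ : Type*} [Inhabited Γ] [Inhabited Λ] (M : Machine Γ Λ)

/-- The word describing the state `q` and the tape with `L` (reversed) to the left of the head
and `R` to the right. -/
def configWord (L : List Γ) (q : Λ) (R : List Γ) : List (ConfigSymbol Γ Λ) :=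
  left :: (L.reverse.map cell ++ state q :: (R.map cell ++ [right]))

/-- The word `x` describes the configuration `c`. -/
def Represents (x : List (ConfigSymbol Γ Λ)) (c : Cfg Γ Λ) : Prop :=
  ∃ L R, x = configWord L c.q R ∧ c.Tape = Tape.mk' (ListBlank.mk L) (ListBlank.mk R)

theorem mk_append_default (l : List Γ) : ListBlank.mk (l ++ [default]) = ListBlank.mk l :=
  Eq.symm (Quotient.sound' (.inl ⟨1, rfl⟩))

/-- The symbols `left`, `right` and `state` occur once each in a configuration word, so the place
where a rule applies is forced. Padding adds blanks and leaves the configuration unchanged; a `move`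
rule performs a step of the machine or reveals that it has halted. -/
theorem represents_of_semiThue {x y : List (ConfigSymbol Γ Λ)} {c : Cfg Γ Λ}
    (hx : Represents x c) (h : SemiThue lhs (rhs M) x y) :
    Represents y c ∨ (∃ d, step M c = some d ∧ Represents y d) ∨ step M c = none := by
  obtain ⟨L, R, rfl, hT⟩ := hx
  obtain ⟨i, A, B, h, rfl⟩ := h
  cases i with
  | padLeft =>
    have h' : [] ++ left :: (L.reverse.map cell ++ state c.q :: (R.map cell ++ [right])) =
      A ++ left :: B := by simpa [configWord, lhs] using h
    rw [List.append_cons_inj_of_notMem (by simp) (by simp)] at h'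
    obtain ⟨rfl, -, rfl⟩ := h'
    exact .inl ⟨L ++ [default], R, by simp [rhs, configWord], by rw [mk_append_default, hT]⟩
  | padRight =>
    have h' : (left :: (L.reverse.map cell ++ state c.q :: R.map cell)) ++ right :: [] =
      A ++ right :: B := by simpa [configWord, lhs] using h
    rw [List.append_cons_inj_of_notMem (by simp) (by simp)] at h'
    obtain ⟨rfl, -, rfl⟩ := h'
    exact .inl ⟨L, R ++ [default], by simp [rhs, configWord], by rw [mk_append_default, hT]⟩
  | move b q a =>
    have h' : (left :: L.reverse.map cell) ++ state c.q :: (R.map cell ++ [right]) =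
      (A ++ [cell b]) ++ state q :: (cell a :: B) := by simpa [configWord, lhs] using h
    rw [List.append_cons_inj_of_notMem (by simp) (by simp)] at h'
    obtain ⟨h1, h2, h3⟩ := h'
    obtain ⟨q', T⟩ := c
    obtain rfl : q' = q := by simpa using h2
    dsimp only at hT h
    subst hT
    cases R with
    | nil => simp at h3
    | cons a' R =>
    cases L with
    | nil => cases A <;> simp at h1
    | cons b' L =>
    simp only [List.map_cons, List.cons_append, List.cons.injEq, cell.injEq] at h3
    obtain ⟨rfl, rfl⟩ := h3
    have h1' : left :: L.reverse.map cell ++ [cell b'] = A ++ [(cell b : ConfigSymbol Γ Λ)] := by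
      simpa using h1
    obtain ⟨rfl, h4⟩ := List.append_inj' h1' rfl
    obtain rfl : b' = b := by simpa using h4
    right
    cases hM : M q' a' with
    | none => right; simp [step, hM]
    | some p =>
      left
      obtain ⟨q, s⟩ := p
      refine ⟨_, by simp only [step, Tape.mk'_head, ListBlank.head_mk, List.headI_cons, hM]; rfl, ?_⟩
      match s with
      | .move .left =>
        refine ⟨L, b' :: a' :: R, by simp [rhs, hM, configWord], ?_⟩
        simp [← ListBlank.cons_mk]
      | .move .right =>
        refine ⟨a' :: b' :: L, R, by simp [rhs, hM, configWord], ?_⟩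
        simp [← ListBlank.cons_mk]
      | .write a =>
        refine ⟨b' :: L, a :: R, by simp [rhs, hM, configWord], ?_⟩
        simp [← ListBlank.cons_mk]
  | eatLeft b =>
    have : halted ∈ configWord L c.q R := by rw [h]; simp [lhs]
    simp [configWord] at this
  | eatRight b =>
    have : halted ∈ configWord L c.q R := by rw [h]; simp [lhs]
    simp [configWord] at this
  | finish =>
    have : halted ∈ configWord L c.q R := by rw [h]; simp [lhs]
    simp [configWord] at this

/-- Configuration words never contain `done`, so a derivation reaching it must pass through a
halting configuration. The arbitrary `y` is allowed because the final domino only checks the last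
symbol of the word. -/
theorem eval_dom_of_derives {x y : List (ConfigSymbol Γ Λ)} {c : Cfg Γ Λ} (hx : Represents x c)
    (h : Relation.ReflTransGen (SemiThue lhs (rhs M)) x (y ++ [done])) :
    (StateTransition.eval (step M) c).Dom := by
  have key : ∀ z, Relation.ReflTransGen (SemiThue lhs (rhs M)) x z →
      (∃ d, StateTransition.Reaches (step M) c d ∧ Represents z d) ∨
        (StateTransition.eval (step M) c).Dom := by
    intro z hz
    induction hz with
    | refl => exact .inl ⟨c, .refl, hx⟩
    | tail _ hs ih =>
      rcases ih with ⟨d, hd, hr⟩ | ih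
      · rcases represents_of_semiThue M hr hs with h | ⟨e, he, h⟩ | h
        · exact .inl ⟨d, hd, h⟩
        · exact .inl ⟨e, hd.tail he, h⟩
        · exact .inr (Part.dom_iff_mem.2 ⟨d, StateTransition.mem_eval.2 ⟨hd, h⟩⟩)
      · exact .inr ih
  rcases key _ h with ⟨d, -, L, R, h, -⟩ | h
  · have : done ∈ configWord L d.q R := by rw [← h]; simp
    simp [configWord] at this
  · exact h

theorem semiThue_rule {M} (i : ConfigRule Γ Λ) (A B : List (ConfigSymbol Γ Λ)) :
    SemiThue lhs (rhs M) (A ++ lhs i ++ B) (A ++ rhs M i ++ B) := ⟨i, A, B, rfl, rfl⟩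

/-- A `move` rule needs a cell on each side of the state; one blank at either end ensures this. -/
theorem exists_derives_padded {x : List (ConfigSymbol Γ Λ)} {c : Cfg Γ Λ} (hx : Represents x c) :
    ∃ b L a R, Relation.ReflTransGen (SemiThue lhs (rhs M)) x (configWord (b :: L) c.q (a :: R)) ∧
      c.Tape = Tape.mk' (ListBlank.mk (b :: L)) (ListBlank.mk (a :: R)) := by
  obtain ⟨L, R, rfl, hT⟩ := hx
  have h1 : SemiThue lhs (rhs M) (configWord L c.q R) (configWord (L ++ [default]) c.q R) := by
    simpa [lhs, rhs, configWord] using semiThue_rule (M := M) padLeft []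
      (L.reverse.map cell ++ state c.q :: (R.map cell ++ [right]))
  have h2 (L' : List Γ) : SemiThue lhs (rhs M) (configWord L' c.q R)
      (configWord L' c.q (R ++ [default])) := by
    refine ⟨padRight, left :: (L'.reverse.map cell ++ state c.q :: R.map cell), [], ?_, ?_⟩ <;>
      simp [lhs, rhs, configWord]
  obtain ⟨b, L', hL⟩ := List.exists_cons_of_ne_nil (l := L ++ [default]) (by simp)
  obtain ⟨a, R', hR⟩ := List.exists_cons_of_ne_nil (l := R ++ [default]) (by simp)
  refine ⟨b, L', a, R', ?_, ?_⟩
  · rw [← hL, ← hR]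
    exact .head h1 (.single (h2 _))
  · rw [← hL, ← hR, mk_append_default, mk_append_default, hT]

theorem semiThue_move (b : Γ) (L : List Γ) (q : Λ) (a : Γ) (R : List Γ) :
    SemiThue lhs (rhs M) (configWord (b :: L) q (a :: R))
      (left :: L.reverse.map cell ++ rhs M (move b q a) ++ (R.map cell ++ [right])) := by
  simpa [lhs, configWord] using semiThue_rule (M := M) (move b q a)
    (left :: L.reverse.map cell) (R.map cell ++ [right])

theorem exists_derives_of_step {x : List (ConfigSymbol Γ Λ)} {c d : Cfg Γ Λ}
    (hx : Represents x c) (h : step M c = some d) :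
    ∃ y, Relation.ReflTransGen (SemiThue lhs (rhs M)) x y ∧ Represents y d := by
  obtain ⟨b, L, a, R, hxy, hT⟩ := exists_derives_padded M hx
  refine ⟨_, hxy.tail (semiThue_move M b L c.q a R), ?_⟩
  obtain ⟨q, T⟩ := c
  dsimp only at hT
  subst hT
  simp only [step, Tape.mk'_head, ListBlank.head_mk, List.headI_cons, Option.map_eq_some_iff] at h
  obtain ⟨⟨q', s⟩, hM, rfl⟩ := h
  match s with
  | .move .left =>
    refine ⟨L, b :: a :: R, by simp [rhs, hM, configWord], ?_⟩
    simp [← ListBlank.cons_mk]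
  | .move .right =>
    refine ⟨a :: b :: L, R, by simp [rhs, hM, configWord], ?_⟩
    simp [← ListBlank.cons_mk]
  | .write a' =>
    refine ⟨b :: L, a' :: R, by simp [rhs, hM, configWord], ?_⟩
    simp [← ListBlank.cons_mk]

/-- The symbol `halted` erases the cells on both sides until `finish` applies. -/
theorem derives_done_of_halted (L R : List Γ) :
    Relation.ReflTransGen (SemiThue lhs (rhs M))
      (left :: (L.reverse.map cell ++ halted :: (R.map cell ++ [right]))) [done] := by
  induction L with
  | nil =>
    induction R with
    | nil => exact .single (semiThue_rule finish [] [])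
    | cons a R ih => exact .head (semiThue_rule (eatRight a) [left] (R.map cell ++ [right])) ih
  | cons b L ih =>
    refine .head ?_ ih
    simpa [lhs, rhs] using semiThue_rule (M := M) (eatLeft b) (left :: L.reverse.map cell)
      (R.map cell ++ [right])

theorem derives_done_of_eval_dom {x : List (ConfigSymbol Γ Λ)} {c : Cfg Γ Λ}
    (hx : Represents x c) (h : (StateTransition.eval (step M) c).Dom) :
    Relation.ReflTransGen (SemiThue lhs (rhs M)) x [done] := by
  simp only [Part.dom_iff_mem, StateTransition.mem_eval] at h
  obtain ⟨d, hcd, hd⟩ := h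
  induction hcd using Relation.ReflTransGen.head_induction_on generalizing x with
  | refl =>
    obtain ⟨b, L, a, R, hxy, hT⟩ := exists_derives_padded M hx
    refine (hxy.tail (semiThue_move M b L d.q a R)).trans ?_
    obtain ⟨q, T⟩ := d
    dsimp only at hT
    subst hT
    have hM : M q a = none := by simpa [step] using hd
    simpa [rhs, hM] using derives_done_of_halted M L R
  | head h _ ih =>
    obtain ⟨y, hxy, hy⟩ := exists_derives_of_step M hx h
    exact hxy.trans (ih hy)

theorem represents_init (l : List Γ) :
    Represents (configWord [] default l) (init l : Cfg Γ Λ) := by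
  exact ⟨[], l, rfl, rfl⟩

end Turing.TM0

/-! ### Post's correspondence problem. -/

/-- `w` is a solution of the instance `(u, v)` of Post's correspondence problem in which the first
word starts with the prefix `s`. -/
def IsPrefixedSolution {ι α : Type*} (u v : ι → List α) (s : List α) (w : List ι) : Prop :=
  s ++ w.flatMap u = w.flatMap v

/-- The prefix acts as a queue: the dominoes `w` remove `w.flatMap v` from its front and append
`w.flatMap u` at its end. -/
theorem IsPrefixedSolution.exists_of_append {ι α : Type*} {u v : ι → List α} {s : List α}
    (w : List ι) (h : ∃ w', IsPrefixedSolution u v (s ++ w.flatMap u) w') :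
    ∃ w', IsPrefixedSolution u v (w.flatMap v ++ s) w' := by
  obtain ⟨w', h⟩ := h
  refine ⟨w ++ w', ?_⟩
  simpa [IsPrefixedSolution] using h

namespace SemiThue

variable {ι α : Type*} (l r : ι → List α) (e : α)

/-- The words written by the dominoes for a semi-Thue system with rules `l i → r i`, the separator
being `none`: one domino for each rule, one for each symbol, and one that ends a derivation when
the symbol `e` has been reached. -/
def written : ι ⊕ Option (Option α) → List (Option α)
  | .inl i => (r i).map some
  | .inr (some a) => [a]
  | .inr none => []

/-- The words read by the dominoes for a semi-Thue system with rules `l i → r i`. -/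
def scanned : ι ⊕ Option (Option α) → List (Option α)
  | .inl i => (l i).map some
  | .inr (some a) => [a]
  | .inr none => [some e, none]

theorem eq_append_of_map_some_append {a b : List α} {t t' : List (Option α)}
    (h : a.map some ++ none :: t = b.map some ++ t') :
    ∃ c, a = b ++ c ∧ t' = c.map some ++ none :: t := by
  induction b generalizing a with
  | nil => exact ⟨a, rfl, h.symm⟩
  | cons x b ih =>
    cases a with
    | nil => simp at h
    | cons y a =>
      simp only [List.map_cons, List.cons_append, List.cons.injEq, Option.some.injEq] at h
      obtain ⟨c, rfl, hc⟩ := ih h.2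
      exact ⟨c, by simp [h.1], hc⟩

/-- In the queue, `y` is the part of the current word still to be scanned and `x` the part already
copied or rewritten, so `x ++ y` is the word derived so far. Induction on the dominoes: a rule
domino is a rewriting step, a copying domino shifts a symbol from `y` to `x`, and the separator
domino starts a new pass. -/
theorem derives_of_isPrefixedSolution {w : List (ι ⊕ Option (Option α))} {x y : List α}
    (h : IsPrefixedSolution (written r) (scanned l e) (y.map some ++ none :: x.map some) w) :
    ∃ p, Relation.ReflTransGen (SemiThue l r) (x ++ y) (p ++ [e]) := by
  induction w generalizing x y with
  | nil => simp [IsPrefixedSolution] at h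
  | cons a w ih =>
    simp only [IsPrefixedSolution, List.flatMap_cons, List.append_assoc, List.cons_append] at h
    match a with
    | .inl i =>
      obtain ⟨y, rfl, hy⟩ := eq_append_of_map_some_append h
      obtain ⟨p, hp⟩ := ih (x := x ++ r i) (y := y) (by
        simpa [IsPrefixedSolution, written] using hy.symm)
      exact ⟨p, .head ⟨i, x, y, by simp, rfl⟩ hp⟩
    | .inr (some (some s)) =>
      obtain ⟨y, rfl, hy⟩ := eq_append_of_map_some_append (b := [s]) h
      obtain ⟨p, hp⟩ := ih (x := x ++ [s]) (y := y) (by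
        simpa [IsPrefixedSolution, written] using hy.symm)
      exact ⟨p, by simpa using hp⟩
    | .inr (some none) =>
      cases y with
      | cons => simp [scanned] at h
      | nil =>
        obtain ⟨p, hp⟩ := ih (x := []) (y := x) (by
          simpa [IsPrefixedSolution, written, scanned] using h)
        exact ⟨p, by simpa using hp⟩
    | .inr none =>
      obtain ⟨y, rfl, hy⟩ := eq_append_of_map_some_append (b := [e]) h
      cases y with
      | cons => simp at hy
      | nil => exact ⟨x, .refl⟩

theorem exists_isPrefixedSolution_of_semiThue {x y : List α} (h : SemiThue l r x y)
    (hy : ∃ w, IsPrefixedSolution (written r) (scanned l e) (y.map some ++ [none]) w) :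
    ∃ w, IsPrefixedSolution (written r) (scanned l e) (x.map some ++ [none]) w := by
  obtain ⟨i, A, B, rfl, rfl⟩ := h
  let copy : List α → List (ι ⊕ Option (Option α)) := List.map fun a => .inr (some (some a))
  have hw (A : List α) : (copy A).flatMap (written r) = A.map some := by
    induction A with
    | nil => rfl
    | cons a A ih => simpa [copy, written] using ih
  have hs (A : List α) : (copy A).flatMap (scanned l e) = A.map some := by
    induction A with
    | nil => rfl
    | cons a A ih => simpa [copy, scanned] using ih
  -- One pass through the word: copy `A`, rewrite `l i`, copy `B`, then copy the separator. The
  -- prefix becomes the next word of the derivation.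
  have := IsPrefixedSolution.exists_of_append (u := written r) (v := scanned l e) (s := [])
    (copy A ++ [.inl i] ++ copy B ++ [.inr (some none)]) (by
      simpa [hw, written] using hy)
  simpa [hs, scanned] using this

theorem exists_isPrefixedSolution_of_derives {x : List α}
    (h : Relation.ReflTransGen (SemiThue l r) x [e]) :
    ∃ w, IsPrefixedSolution (written r) (scanned l e) (x.map some ++ [none]) w := by
  induction h using Relation.ReflTransGen.head_induction_on with
  | refl => exact ⟨[.inr none], by simp [IsPrefixedSolution, written, scanned]⟩
  | head h _ ih => exact exists_isPrefixedSolution_of_semiThue l r e h ih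

end SemiThue

open Turing TM0 in
theorem Turing.TM0.eval_dom_iff_exists_isPrefixedSolution {Γ Λ : Type*} [Inhabited Γ]
    [Inhabited Λ] (M : Machine Γ Λ) (t : List Γ) :
    (eval M t).Dom ↔ ∃ w, IsPrefixedSolution (SemiThue.written (ConfigRule.rhs M))
      (SemiThue.scanned ConfigRule.lhs ConfigSymbol.done)
      ((configWord [] default t).map some ++ [none]) w := by
  change (StateTransition.eval (step M) (init t)).Dom ↔ _
  constructor
  · exact fun h => SemiThue.exists_isPrefixedSolution_of_derives _ _ _
      (derives_done_of_eval_dom M (represents_init t) h)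
  · rintro ⟨w, hw⟩
    obtain ⟨p, hp⟩ := SemiThue.derives_of_isPrefixedSolution (x := []) _ _ _ hw
    exact eval_dom_of_derives M (represents_init t) hp

/-- Reversing both the words and the order of the dominoes turns the prefix into a suffix; the
bijections move everything to types `Fin`. -/
theorem exists_isPrefixedSolution_iff_reverse {ι ι' α α' : Type*} (e : ι ≃ ι') (f : α ≃ α')
    (u v : ι → List α) (s : List α) :
    (∃ w, IsPrefixedSolution u v s w) ↔
      ∃ w : List ι', (w.flatMap fun j => ((u (e.symm j)).map f).reverse) ++ (s.map f).reverse =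
        w.flatMap fun j => ((v (e.symm j)).map f).reverse := by
  have key (w : List ι) : IsPrefixedSolution u v s w ↔
      ((w.map e).reverse.flatMap fun j => ((u (e.symm j)).map f).reverse) ++ (s.map f).reverse =
        (w.map e).reverse.flatMap fun j => ((v (e.symm j)).map f).reverse := by
    have h (g : ι → List α) :
        ((w.map e).reverse.flatMap fun j => ((g (e.symm j)).map f).reverse) =
          ((w.flatMap g).map f).reverse := by
      rw [List.map_flatMap, List.reverse_flatMap, ← List.map_reverse, List.flatMap_map]
      simp [Function.comp_def]
    rw [h, h, ← List.reverse_append, ← List.map_append, List.reverse_inj,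
      f.injective.list_map.eq_iff, IsPrefixedSolution]
  constructor
  · rintro ⟨w, hw⟩
    exact ⟨_, (key w).1 hw⟩
  · rintro ⟨w, hw⟩
    refine ⟨w.reverse.map e.symm, (key _).2 ?_⟩
    simpa [Function.comp_def] using hw

theorem primrec_replicate {α : Type*} [Primcodable α] (a : α) :
    Primrec fun n => List.replicate n a := by
  have h : Primrec₂ fun (_ : ℕ) (l : List α) => a :: l :=
    Primrec.list_cons.comp (Primrec.const a) Primrec.snd
  refine (Primrec.nat_rec₁ [] h).of_eq fun n => ?_
  induction n with
  | zero => rfl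
  | succ n ih => exact congrArg _ ih

/-- A fixed instance of Post's correspondence problem, with a suffix that depends on a number,
whose solvability is undecidable. -/
theorem exists_not_computablePred_correspondence :
    ∃ (m k : ℕ) (u v : Fin m → List (Fin k)) (s : ℕ → List (Fin k)), Primrec s ∧
      ¬ ComputablePred fun n => ∃ w : List (Fin m), w.flatMap u ++ s n = w.flatMap v := by
  obtain ⟨Γ, Λ, _, _, _, _, M, x, y, z, hM⟩ := exists_TM0_not_computablePred_halts
  obtain ⟨m, ⟨e⟩⟩ := Finite.exists_equiv_fin
    (ConfigRule Γ Λ ⊕ Option (Option (ConfigSymbol Γ Λ)))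
  obtain ⟨k, ⟨f⟩⟩ := Finite.exists_equiv_fin (Option (ConfigSymbol Γ Λ))
  have key (n : ℕ) := (Turing.TM0.eval_dom_iff_exists_isPrefixedSolution M
    (x :: y :: List.replicate n z)).trans (exists_isPrefixedSolution_iff_reverse e f _ _ _)
  refine ⟨m, k, _, _, _, ?_, fun h => hM (h.of_eq fun n => (key n).symm)⟩
  -- The reversed initial configuration word is a constant, a run of `n` equal letters, and another
  -- constant.
  have h' := Primrec.list_append.comp (Primrec.list_append.comp
    (Primrec.const [f none, f (some ConfigSymbol.right)])
    (primrec_replicate (f (some (ConfigSymbol.cell z)))))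
    (Primrec.const [f (some (ConfigSymbol.cell y)), f (some (ConfigSymbol.cell x)),
      f (some (ConfigSymbol.state default)), f (some ConfigSymbol.left)])
  exact h'.of_eq fun n => by simp [Turing.TM0.configWord]

/-! ### The branching transducers and the relations they compute. -/

/-- The words printed by the transducer with nine branches `0, …, 8` that belongs to an instance of
Post's correspondence problem: three branches print the image of the input under `u` and then `s`,
three branches print the image under `v`, and three branches print nothing. -/
def branchOutput {A B : Type*} (u v : A → List B) (s : List B) : TapeSymbol A → Fin 18 → List B
  | .initMark, _ => []
  | .letter a, q => if q < 3 then u a else if q < 6 then v a else []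
  | .endMark, q => if q < 3 then s else []

/-- The transducer with the nine branches `0, …, 8`, entered from `0` by the matrix `W` and left
by the matrix `E`, which is meant to move the branch `i` to the halting state `i + 9`. -/
def branchTransducer {K A B : Type*} [Zero K] [One K] (W E : Matrix (Fin 18) (Fin 18) K)
    (u v : A → List B) (s : List B) : Transducer K (Fin 18) A B where
  V
    | .initMark => W
    | .letter _ => 1
    | .endMark => E
  f := branchOutput u v s
  q₀ := 0
  acc := Finset.univ.image fun i : Fin 6 => Fin.natAdd 9 (Fin.castAdd 3 i)
  rej := Finset.univ.image fun i : Fin 3 => Fin.natAdd 9 (Fin.natAdd 6 i)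
  disjoint_acc_rej := by decide

namespace Transducer

variable {K Q A B : Type*} [Semiring K] [Fintype Q] (T : Transducer K Q A B)

theorem move_single (t : TapeSymbol A) (q : Q) (w : List B) (c : K) :
    T.move t (Finsupp.single (q, w) c) =
      ∑ p : Q, Finsupp.single (p, w ++ T.f t q) (c * T.V t q p) := by
  rw [move, Finsupp.sum_single_index]
  simp

theorem move_sum {ι : Type*} (t : TapeSymbol A) (I : Finset ι) (ψ : ι → (Q × List B) →₀ K) :
    T.move t (∑ i ∈ I, ψ i) = ∑ i ∈ I, T.move t (ψ i) := by
  simp only [move]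
  rw [Finsupp.sum_finsetSum_index]
  · simp
  · intro x b₁ b₂
    simp [add_mul, Finset.sum_add_distrib]

theorem move_single_of_forall_eq_ite [DecidableEq Q] (t : TapeSymbol A) (q r : Q)
    (h : ∀ p, T.V t q p = if p = r then 1 else 0) (w : List B) (c : K) :
    T.move t (Finsupp.single (q, w) c) = Finsupp.single (r, w ++ T.f t q) c := by
  rw [move_single, Finset.sum_eq_single r]
  · simp [h]
  · intro p _ hp
    simp [h, hp]
  · simp

end Transducer

namespace branchTransducer

variable {K A B : Type*} [Semiring K] {W E : Matrix (Fin 18) (Fin 18) K}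
  (u v : A → List B) (s : List B) {c : K}

/-- The configuration with the same weight on each of the nine branches `e i`, where `x i` has
been printed on the branch `i`. -/
noncomputable def branches (e : Fin 9 → Fin 18) (c : K) (x : Fin 9 → List B) :
    (Fin 18 × List B) →₀ K :=
  ∑ i, Finsupp.single (e i, x i) c

theorem branches_apply {e : Fin 9 → Fin 18} (he : Function.Injective e) (c : K)
    (x : Fin 9 → List B) (i : Fin 9) (w : List B) [Decidable (x i = w)] :
    branches e c x (e i, w) = if x i = w then c else 0 := by
  classical
  rw [branches, Finsupp.finsetSum_apply, Finset.sum_eq_single i]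
  · simp [Finsupp.single_apply]
  · intro j _ hj
    simp [he.eq_iff, hj]
  · simp

theorem branches_apply_eq_zero {e : Fin 9 → Fin 18} (c : K) (x : Fin 9 → List B) {q : Fin 18}
    (hq : ∀ i, e i ≠ q) (w : List B) : branches e c x (q, w) = 0 := by
  classical
  rw [branches, Finsupp.finsetSum_apply]
  exact Finset.sum_eq_zero fun i _ => by simp [hq i]

theorem move_initMark (hW : ∀ p, W 0 p = if p < 9 then c else 0) :
    (branchTransducer W E u v s).move .initMark (Finsupp.single (0, []) 1) =
      branches (Fin.castAdd 9) c fun _ => [] := by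
  rw [Transducer.move_single, branches]
  change ∑ p : Fin (9 + 9), Finsupp.single (p, _) (1 * W 0 p) = _
  rw [Fin.sum_univ_add]
  have h1 (i : Fin 9) : W 0 (Fin.castAdd 9 i) = c := by
    rw [hW, if_pos]
    revert i
    decide
  have h2 (i : Fin 9) : W 0 (Fin.addNat i 9) = 0 := by
    rw [hW, if_neg]
    revert i
    decide
  simp [h1, h2, branchTransducer, branchOutput]

theorem move_letter (a : A) (x : Fin 9 → List B) :
    (branchTransducer W E u v s).move (.letter a) (branches (Fin.castAdd 9) c x) =
      branches (Fin.castAdd 9) c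
        fun i => x i ++ branchOutput u v s (.letter a) (Fin.castAdd 9 i) := by
  rw [branches, Transducer.move_sum, branches]
  refine Finset.sum_congr rfl fun i _ => ?_
  refine Transducer.move_single_of_forall_eq_ite _ _ _ _ (fun p => ?_) _ _
  simp [branchTransducer, Matrix.one_apply, eq_comm]

theorem move_endMark
    (hE : ∀ i p, E (Fin.castAdd 9 i) p = if p = Fin.natAdd 9 i then 1 else 0) (x : Fin 9 → List B) :
    (branchTransducer W E u v s).move .endMark (branches (Fin.castAdd 9) c x) =
      branches (Fin.natAdd 9) c
        fun i => x i ++ branchOutput u v s .endMark (Fin.castAdd 9 i) := by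
  rw [branches, Transducer.move_sum, branches]
  refine Finset.sum_congr rfl fun i _ => ?_
  exact Transducer.move_single_of_forall_eq_ite _ _ _ _ (hE i) _ _

theorem filter_branches (x : Fin 9 → List B) :
    (branches (Fin.castAdd 9) c x).filter (fun y => y.1 ∉ (branchTransducer W E u v s).acc ∧
      y.1 ∉ (branchTransducer W E u v s).rej) = branches (Fin.castAdd 9) c x := by
  rw [branches, Finsupp.filter_sum]
  refine Finset.sum_congr rfl fun i _ => Finsupp.filter_single_of_pos _ ?_
  simp only [branchTransducer]
  revert i
  decide

theorem branches_apply_of_mem_acc (x : Fin 9 → List B) {p : Fin 18}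
    (hp : p ∈ (branchTransducer W E u v s).acc) (w : List B) :
    branches (Fin.castAdd 9) c x (p, w) = 0 := by
  refine branches_apply_eq_zero _ _ (fun i => ?_) _
  simp only [branchTransducer] at hp
  revert p i
  decide

/-- Running a measure-and-move step function along the input tape: if the step function treats
configurations as probabilistic and quantum transducers do, with `g` the probability of a
weight, then the probability to accept is given by the six accepting branches. -/
theorem foldl_step_acc [DecidableEq B] (hW : ∀ p, W 0 p = if p < 9 then c else 0)
    (hE : ∀ i p, E (Fin.castAdd 9 i) p = if p = Fin.natAdd 9 i then 1 else 0) (g : K → ℝ)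
    (g_zero : g 0 = 0)
    (step : TotalState K (Fin 18) B → TapeSymbol A → TotalState K (Fin 18) B)
    (step_non : ∀ S t, (step S t).non = ((branchTransducer W E u v s).move t S.non).filter
      fun x => x.1 ∉ (branchTransducer W E u v s).acc ∧ x.1 ∉ (branchTransducer W E u v s).rej)
    (step_acc : ∀ S t w, (step S t).acc w = S.acc w +
      ∑ p ∈ (branchTransducer W E u v s).acc, g ((branchTransducer W E u v s).move t S.non (p, w)))
    (a : List A) (w : List B) :
    ((tape a).foldl step (branchTransducer W E u v s).init).acc w =
      3 * ((if a.flatMap u ++ s = w then g c else 0) + if a.flatMap v = w then g c else 0) := by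
  -- While letters are read, all the weight stays on the non-halting branches, so the measurement
  -- changes nothing and nothing is accepted.
  have key : ∀ (a : List A) (S : TotalState K (Fin 18) B) (x : Fin 9 → List B),
      S.non = branches (Fin.castAdd 9) c x → S.acc = 0 →
      ((a.map TapeSymbol.letter).foldl step S).non = branches (Fin.castAdd 9) c (fun i =>
        x i ++ a.flatMap fun a => branchOutput u v s (.letter a) (Fin.castAdd 9 i)) ∧
      ((a.map TapeSymbol.letter).foldl step S).acc = 0 := by
    intro a
    induction a with
    | nil =>
      intro S x hS hS'
      simpa using ⟨hS, hS'⟩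
    | cons b a ih =>
      intro S x hS hS'
      have h := ih (step S (.letter b)) _
        (by rw [step_non, hS, move_letter, filter_branches]) (by
          funext w
          rw [step_acc, hS', hS, move_letter, Finset.sum_eq_zero]
          · simp
          · intro p hp
            rw [branches_apply_of_mem_acc u v s _ hp, g_zero])
      simpa using h
  obtain ⟨h1, h2⟩ := key a (step (branchTransducer W E u v s).init .initMark) (fun _ => [])
    (by
      rw [step_non]
      change Finsupp.filter _ ((branchTransducer W E u v s).move _ (Finsupp.single (0, []) 1)) = _
      rw [move_initMark u v s hW, filter_branches])
    (by
      funext w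
      rw [step_acc]
      change 0 + ∑ p ∈ _, g ((branchTransducer W E u v s).move _ (Finsupp.single (0, []) 1) _) = _
      rw [move_initMark u v s hW, Finset.sum_eq_zero]
      · simp
      · intro p hp
        rw [branches_apply_of_mem_acc u v s _ hp, g_zero])
  rw [tape, List.foldl_cons, List.foldl_append, List.foldl_cons, List.foldl_nil, step_acc, h1, h2,
    move_endMark u v s hE]
  -- Distinct branches end in distinct states, so equal outputs add probabilities and amplitudes do
  -- not interfere.
  have hinj : Function.Injective (Fin.natAdd 9 : Fin 9 → Fin 18) := Fin.natAdd_injective 9 9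
  have hacc : (branchTransducer W E u v s).acc =
      Finset.univ.image fun i : Fin 6 => Fin.natAdd 9 (Fin.castAdd 3 i) := rfl
  rw [hacc, Finset.sum_image (fun i _ j _ h => Fin.castAdd_injective 6 3 (hinj h))]
  simp only [branches_apply hinj]
  simp [Fin.sum_univ_six, branchOutput, Fin.lt_def, apply_ite g, g_zero]
  ring

/-- The three possible values are 2/3, 1/3 and 0; the bounds 2/3 and 1 - 2/3 are both attained. -/
theorem computesWithProb {A B : Type*} [DecidableEq B] (u v : A → List B) (s : List B)
    {P : List B → List A → ℝ} (hP : ∀ w a, P w a =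
      3 * ((if a.flatMap u ++ s = w then 1 / 9 else 0) + if a.flatMap v = w then 1 / 9 else 0)) :
    ComputesWithProb P {x | x.1.flatMap u ++ s = x.2 ∧ x.1.flatMap v = x.2} (2 / 3) := by
  intro a w
  rw [hP]
  simp only [Set.mem_ofPred_eq]
  split_ifs with h1 h2 h2 <;> simp [h1, h2] <;> norm_num

end branchTransducer

open TransducerCode

namespace branchTransducer

/-- The matrix with rational entries by which a probabilistic transducer enters the branches. -/
def splitProb (_ p : Fin 18) : ℚ := if p < 9 then 1 / 9 else 0

/-- The vector that defines the reflection `splitAmp`. -/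
def splitVec (p : Fin 18) : ℚ := if p = 0 then 2 else if p < 9 then -1 else 0

/-- The reflection with rational entries by which a quantum transducer enters the branches. -/
def splitAmp (q p : Fin 18) : ℚ := (if q = p then 1 else 0) - 1 / 6 * (splitVec q * splitVec p)

/-- The vector `splitVec` is three times the difference of the first basis vector and the unit
vector with nine entries 1/3, so the reflection exchanges these two. Its squared norm is 12, whence
the factor 2/12 = 1/6. -/
theorem splitAmp_zero (p : Fin 18) : splitAmp 0 p = if p < 9 then 1 / 3 else 0 := by
  revert p
  decide +kernel

/-- The matrix by which a probabilistic transducer leaves the branches. -/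
def haltProb (q p : Fin 18) : ℚ := if p = if q < 9 then q + 9 else q then 1 else 0

/-- The permutation matrix by which a quantum transducer leaves the branches. -/
def haltAmp (q p : Fin 18) : ℚ := if p = q + 9 then 1 else 0

theorem haltProb_castAdd (i : Fin 9) (p : Fin 18) :
    haltProb (Fin.castAdd 9 i) p = if p = Fin.natAdd 9 i then 1 else 0 := by
  revert i p
  decide +kernel

theorem haltAmp_castAdd (i : Fin 9) (p : Fin 18) :
    haltAmp (Fin.castAdd 9 i) p = if p = Fin.natAdd 9 i then 1 else 0 := by
  revert i p
  decide +kernel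

/-- Addition in `Fin 18` is modulo 18, so `haltAmp` exchanges branches and halting states. Return
from halting states is permitted for quantum machines only; this is why `haltProb` fixes the halting
states instead. -/
theorem sum_haltAmp_mul (q p : Fin 18) :
    ∑ r, haltAmp q r * haltAmp p r = if q = p then 1 else 0 := by
  revert q p
  decide +kernel

theorem of_mem_unitaryGroup {n : Type*} [Fintype n] [DecidableEq n] {U : n → n → ℚ}
    (h : ∀ q p, ∑ r, U q r * U p r = if q = p then 1 else 0) :
    Matrix.of (fun q p => (U q p : ℂ)) ∈ Matrix.unitaryGroup n ℂ := by
  rw [Matrix.mem_unitaryGroup_iff]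
  ext q p
  simp only [Matrix.mul_apply, Matrix.star_apply, Matrix.of_apply, Matrix.one_apply,
    RCLike.star_def, map_ratCast]
  have h' := congrArg (Rat.cast : ℚ → ℂ) (h q p)
  rw [apply_ite (Rat.cast : ℚ → ℂ), Rat.cast_one, Rat.cast_zero] at h'
  rw [← h']
  push_cast
  rfl

theorem of_mem_rowStochastic {n : Type*} [Fintype n] [DecidableEq n] {U : n → n → ℚ}
    (h₀ : ∀ q p, 0 ≤ U q p) (h₁ : ∀ q, ∑ p, U q p = 1) :
    Matrix.of (fun q p => (U q p : ℝ)) ∈ Matrix.rowStochastic ℝ n := by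
  refine Matrix.mem_rowStochastic_iff_sum.2 ⟨fun q p => ?_, fun q => ?_⟩
  · rw [Matrix.of_apply]
    exact_mod_cast h₀ q p
  · simp only [Matrix.of_apply]
    exact_mod_cast h₁ q

/-- Expanding the square of the reflection, the terms beyond the identity have coefficients -1/6 -
1/6 + 12/36 = 0. -/
theorem sum_splitAmp_mul (q p : Fin 18) :
    ∑ r, splitAmp q r * splitAmp p r = if q = p then 1 else 0 := by
  have h : ∑ r, splitVec r * splitVec r = 12 := by decide +kernel
  have e (r : Fin 18) : splitAmp q r * splitAmp p r =
      (if q = r then if p = r then 1 else 0 else 0)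
      - 1 / 6 * (if q = r then splitVec p * splitVec r else 0)
      - 1 / 6 * (if p = r then splitVec q * splitVec r else 0)
      + 1 / 36 * (splitVec q * splitVec p) * (splitVec r * splitVec r) := by
    simp only [splitAmp]
    split_ifs <;> ring
  simp only [e, Finset.sum_add_distrib, Finset.sum_sub_distrib, ← Finset.mul_sum, h,
    Finset.sum_ite_eq, Finset.mem_univ, if_true, eq_comm (a := p) (b := q)]
  ring

/-- The probabilistic transducer of an instance of Post's correspondence problem. -/
noncomputable def pfst {A B : Type*} (u v : A → List B) (s : List B) : PFST (Fin 18) A B where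
  toTransducer := branchTransducer (Matrix.of fun q p => (splitProb q p : ℝ))
    (Matrix.of fun q p => (haltProb q p : ℝ)) u v s
  stochastic t := by
    match t with
    | .initMark => exact of_mem_rowStochastic (by decide +kernel) (by decide +kernel)
    | .letter _ => exact one_mem _
    | .endMark => exact of_mem_rowStochastic (by decide +kernel) (by decide +kernel)
  endMark_halts q p hp hp' := by
    have h : haltProb q p = 0 := by
      simp only [branchTransducer] at hp hp'
      revert q p
      decide +kernel
    simp [branchTransducer, h]

theorem pfst_computes {A B : Type*} (u v : A → List B) (s : List B) :
    (pfst u v s).Computes {x | x.1.flatMap u ++ s = x.2 ∧ x.1.flatMap v = x.2} (2 / 3) := by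
  classical
  refine computesWithProb u v s fun w a => ?_
  refine foldl_step_acc u v s (c := 1 / 9) ?_ (fun i p => ?_) id rfl _ (fun _ _ => rfl) (fun _ _ _ => rfl) a w
  · intro p
    simp only [Matrix.of_apply, splitProb]
    split_ifs <;> norm_num
  · rw [Matrix.of_apply, haltProb_castAdd]
    split_ifs <;> norm_num

/-- The quantum transducer of an instance of Post's correspondence problem. -/
noncomputable def qfst {A B : Type*} (u v : A → List B) (s : List B) : QFST (Fin 18) A B where
  toTransducer := branchTransducer (Matrix.of fun q p => (splitAmp q p : ℂ))
    (Matrix.of fun q p => (haltAmp q p : ℂ)) u v s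
  unitary t := by
    match t with
    | .initMark => exact of_mem_unitaryGroup sum_splitAmp_mul
    | .letter _ => exact one_mem _
    | .endMark => exact of_mem_unitaryGroup sum_haltAmp_mul
  endMark_halts q p hq hq' hp hp' := by
    have h : haltAmp q p = 0 := by
      simp only [branchTransducer] at hq hq' hp hp'
      revert q p
      decide +kernel
    simp [branchTransducer, h]

theorem qfst_computes {A B : Type*} (u v : A → List B) (s : List B) :
    (qfst u v s).Computes {x | x.1.flatMap u ++ s = x.2 ∧ x.1.flatMap v = x.2} (2 / 3) := by
  classical
  refine computesWithProb u v s fun w a => ?_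
  -- Amplitude 1/3 has squared modulus 1/9, the probability of a branch.
  refine (foldl_step_acc u v s (c := 1 / 3) ?_ (fun i p => ?_) (fun c => ‖c‖ ^ 2) (by simp) _ (fun _ _ => rfl)
    (fun _ _ _ => rfl) a w).trans (by norm_num)
  · intro p
    rw [Matrix.of_apply, splitAmp_zero]
    split_ifs <;> norm_num
  · rw [Matrix.of_apply, haltAmp_castAdd]
    split_ifs <;> norm_num

end branchTransducer

/-! ### Descriptions of the branching transducers. -/

namespace TransducerCode

/-- The list of the values of a function on tape symbols, in the order of `symbolIndex`. -/
def symbolList {m : ℕ} {β : Type*} (g : TapeSymbol (Fin m) → β) : List β :=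
  g .initMark :: g .endMark :: List.ofFn fun a => g (.letter a)

theorem symbolList_getElem? {m : ℕ} {β : Type*} (g : TapeSymbol (Fin m) → β)
    (t : TapeSymbol (Fin m)) : (symbolList g)[symbolIndex t]? = some (g t) := by
  cases t <;> simp [symbolList, symbolIndex]

/-- The description of a branching transducer; `N` contains the names of the numbers. -/
def ofBranches {m k : ℕ} (N : TapeSymbol (Fin m) → Fin 18 → Fin 18 → ℕ)
    (u v : Fin m → List (Fin k)) (s : List (Fin k)) : TransducerCode where
  states := 18
  inputs := m
  outputs := k
  initial := 0
  acc := [9, 10, 11, 12, 13, 14]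
  rej := [15, 16, 17]
  matrix := symbolList fun t => List.ofFn fun q => List.ofFn fun p => N t q p
  output := symbolList fun t => List.ofFn fun q => (branchOutput u v s t q).map Fin.val

theorem getElem?_ofFn_val {n : ℕ} {β : Type*} (g : Fin n → β) (i : Fin n) :
    (List.ofFn g)[(i : ℕ)]? = some (g i) := by
  simp

theorem entry_ofBranches {m k : ℕ} (N : TapeSymbol (Fin m) → Fin 18 → Fin 18 → ℕ)
    (u v : Fin m → List (Fin k)) (s : List (Fin k)) (t : TapeSymbol (Fin m)) (q p : Fin 18) :
    (ofBranches N u v s).entry (symbolIndex t) q p = some (N t q p) := by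
  simp only [entry, ofBranches, symbolList_getElem?, Option.bind_some, getElem?_ofFn_val]

theorem word_ofBranches {m k : ℕ} (N : TapeSymbol (Fin m) → Fin 18 → Fin 18 → ℕ)
    (u v : Fin m → List (Fin k)) (s : List (Fin k)) (t : TapeSymbol (Fin m)) (q : Fin 18) :
    (ofBranches N u v s).word (symbolIndex t) q =
      some ((branchOutput u v s t q).map fun b => (b : ℕ)) := by
  simp only [word, ofBranches, symbolList_getElem?, Option.bind_some, getElem?_ofFn_val]
  simp [List.map_eq_flatMap]

theorem describes_ofBranches {m k : ℕ} {K : Type*} [Zero K] [One K] {ν : ℕ → Option K}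
    (W E : Matrix (Fin 18) (Fin 18) K) (N : TapeSymbol (Fin m) → Fin 18 → Fin 18 → ℕ)
    (u v : Fin m → List (Fin k)) (s : List (Fin k))
    (hN : ∀ t q p, ν (N t q p) = some ((branchTransducer W E u v s).V t q p)) :
    Describes ν (ofBranches N u v s) (branchTransducer W E u v s) := by
  refine ⟨rfl, ?_, ?_, fun t (q : Fin 18) (p : Fin 18) => ?_, fun t (q : Fin 18) => ?_⟩
  · change ∀ q : Fin 18, q ∈ Finset.univ.image _ ↔ (q : ℕ) ∈ [9, 10, 11, 12, 13, 14]
    decide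
  · change ∀ q : Fin 18, q ∈ Finset.univ.image _ ↔ (q : ℕ) ∈ [15, 16, 17]
    decide
  · exact (congrArg (fun x => x.bind ν) (entry_ofBranches N u v s t q p)).trans (hN t q p)
  · exact word_ofBranches N u v s t q

theorem primrec_ofBranches {m k : ℕ} (N : TapeSymbol (Fin m) → Fin 18 → Fin 18 → ℕ)
    (u v : Fin m → List (Fin k)) {s : ℕ → List (Fin k)} (hs : Primrec s) :
    Primrec fun n => ofBranches N u v (s n) := by
  have h : Primrec fun n => (ofBranches N u v (s n)).output := by
    -- The suffix is printed at the end marker only, so at the other symbols it may be replaced by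
    -- the empty word and the output is constant in `n`.
    have h₀ : Primrec fun _ : ℕ => List.ofFn fun q =>
        (branchOutput u v [] .initMark q).map Fin.val := Primrec.const _
    have h₁ : Primrec fun _ : ℕ => List.ofFn fun a => List.ofFn fun q =>
        (branchOutput u v [] (.letter a) q).map Fin.val := Primrec.const _
    refine Primrec.list_cons.comp h₀ (Primrec.list_cons.comp
      (Primrec.list_ofFn fun q => ?_) h₁)
    refine Primrec.list_map ?_ (Primrec.fin_val.comp Primrec.snd).to₂
    simp only [branchOutput]
    split_ifs
    · exact hs
    · exact Primrec.const []
  refine (Primrec.of_equiv_iff equivTuple).1 ?_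
  exact (Primrec.const _).pair <| (Primrec.const _).pair <| (Primrec.const _).pair <|
    (Primrec.const _).pair <| (Primrec.const _).pair <| (Primrec.const _).pair <|
    (Primrec.const _).pair h

end TransducerCode

/-! ### The reduction from the correspondence problem. -/

/-- Every instance of the reduction satisfies the promise, so a decision procedure that is partial
in general becomes total after composition with it. -/
theorem ComputablePred.of_partrec_bool {P : ℕ → Prop} {f : ℕ →. Bool} (hf : Partrec f)
    (h : ∀ n, ∃ b ∈ f n, (b = true ↔ ¬ P n)) : ComputablePred P := by
  choose g hg hP using h
  refine ComputablePred.computable_iff.2 ⟨fun n => !g n,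
    Primrec.not.to_comp.comp (hf.of_eq_tot hg), ?_⟩
  funext n
  have := hP n
  cases hn : g n <;> simp_all

theorem correspondence_eq_empty_iff {A B : Type*} (u v : A → List B) (s : List B) :
    {x : List A × List B | x.1.flatMap u ++ s = x.2 ∧ x.1.flatMap v = x.2} = ∅ ↔
      ¬ ∃ a : List A, a.flatMap u ++ s = a.flatMap v := by
  simp only [Set.eq_empty_iff_forall_notMem, Set.mem_ofPred_eq, Prod.forall, not_and, not_exists]
  exact ⟨fun h a ha => h a _ rfl ha.symm, fun h a w h1 h2 => h a (h1.trans h2.symm)⟩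

theorem PFST.not_emptinessDecidable {ν : ℕ → Option ℝ}
    (hν : ∀ r : ℚ, ∃ n : ℕ, ν n = some (r : ℝ)) : ¬ PFST.EmptinessDecidable ν (2 / 3) := by
  rintro ⟨d, hd, h⟩
  obtain ⟨m, k, u, v, s, hs, hP⟩ := exists_not_computablePred_correspondence
  -- The matrices do not depend on the suffix, so names chosen for the empty suffix serve for every
  -- `s n`.
  have hN : ∀ (t : TapeSymbol (Fin m)) (q p : Fin 18), ∃ n : ℕ,
      ν n = some ((branchTransducer.pfst u v []).V t q p) := by
    intro t q p
    match t with
    | .initMark => exact hν (branchTransducer.splitProb q p)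
    | .letter _ =>
      have h := hν (if q = p then 1 else 0)
      rw [apply_ite Rat.cast, Rat.cast_one, Rat.cast_zero] at h
      exact h
    | .endMark => exact hν (branchTransducer.haltProb q p)
  choose N hN using hN
  refine hP (ComputablePred.of_partrec_bool
    (hd.comp (primrec_ofBranches N u v hs).to_comp) fun n => ?_)
  obtain ⟨b, hb, hb'⟩ := h (ofBranches N u v (s n)) (branchTransducer.pfst u v (s n)) _
    (describes_ofBranches _ _ N u v (s n) hN) (branchTransducer.pfst_computes u v (s n))
  exact ⟨b, hb, hb'.trans (correspondence_eq_empty_iff u v (s n))⟩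

theorem QFST.not_emptinessDecidable {ν : ℕ → Option ℂ}
    (hν : ∀ r : ℚ, ∃ n : ℕ, ν n = some (r : ℂ)) : ¬ QFST.EmptinessDecidable ν (2 / 3) := by
  rintro ⟨d, hd, h⟩
  obtain ⟨m, k, u, v, s, hs, hP⟩ := exists_not_computablePred_correspondence
  -- As in the probabilistic case, one choice of names serves all suffixes; the amplitudes are
  -- rational by the choice of nine branches.
  have hN : ∀ (t : TapeSymbol (Fin m)) (q p : Fin 18), ∃ n : ℕ,
      ν n = some ((branchTransducer.qfst u v []).V t q p) := by
    intro t q p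
    match t with
    | .initMark => exact hν (branchTransducer.splitAmp q p)
    | .letter _ =>
      have h := hν (if q = p then 1 else 0)
      rw [apply_ite Rat.cast, Rat.cast_one, Rat.cast_zero] at h
      exact h
    | .endMark => exact hν (branchTransducer.haltAmp q p)
  choose N hN using hN
  refine hP (ComputablePred.of_partrec_bool
    (hd.comp (primrec_ofBranches N u v hs).to_comp) fun n => ?_)
  obtain ⟨b, hb, hb'⟩ := h (ofBranches N u v (s n)) (branchTransducer.qfst u v (s n)) _
    (describes_ofBranches _ _ N u v (s n) hN) (branchTransducer.qfst_computes u v (s n))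
  exact ⟨b, hb, hb'.trans (correspondence_eq_empty_iff u v (s n))⟩

theorem mainTheorem1 :
    (∀ ν : ℕ → Option ℝ, (∀ r : ℚ, ∃ n : ℕ, ν n = some (r : ℝ)) →
      ¬ PFST.EmptinessDecidable ν (2 / 3)) ∧
    (∀ ν : ℕ → Option ℂ, (∀ r : ℚ, ∃ n : ℕ, ν n = some (r : ℂ)) →
      ¬ QFST.EmptinessDecidable ν (2 / 3)) :=
  ⟨fun _ hν => PFST.not_emptinessDecidable hν, fun _ hν => QFST.not_emptinessDecidable hν⟩
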